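/- Forcing notions are preordered sets in which the stronger condition is the greater one; $p,q\in\mathbb P$ are compatible if they have a common upper bound. $\mathbb P$ is ccc if every set of pairwise incompatible conditions is countable, and $\sigma$-centered if $\mathbb P=\bigcup_{n\in\omega}C_n$ where every finite subset of each $C_n$ has an upper bound in $\mathbb P$. A Souslin forcing notion is a preorder $\mathbb Q$ whose underlying set is an analytic subset of a Polish space $X$ and whose order and incompatibility relation are analytic subsets of $X\times X$. A map $i:\mathbb P\to\mathbb Q$ is a complete embedding if it preserves the order and incompatibility, and for every $q\in\mathbb Q$ there is $p\in\mathbb P$ such that $i(p')$ is compatible with $q$ for all $p'\ge p$. The forcing $\mathrm{RO}^+(\mathbb Q)$ consists of the nonzero elements of the Boolean completion of $\mathbb Q$ (nonempty regular open subsets of $\mathbb Q$, where the open sets are those closed under passing to stronger conditions; smaller sets are stronger). For $A\subseteq 2^\omega$ let $\mathbb Q^A$ be the set of pairs $\langle r,w\rangle$ where $r$ is a finite partial function from $2^{<\omega}$ to $2$ and $w$ is a finite subset of $A$, ordered by: $\langle r_1,w_1\rangle\le\langle r_2,w_2\rangle$ if and only if $r_1\subseteq r_2$, $w_1\subseteq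 w_2$, and $r_2(\nu)=1$ for every $\nu\in\mathrm{dom}(r_2)\setminus\mathrm{dom}(r_1)$ that is an initial segment of some $\eta\in w_1$. Theorem. (1) For every $A\subseteq 2^\omega$ the partial order $\mathbb Q^A$ is $\sigma$-centered. If $A$ is not analytic, then for every ccc Souslin forcing notion $\mathbb Q$ there is no complete embedding of $\mathbb Q^A$ into $\mathbb Q$, and none into $\mathrm{RO}^+(\mathbb Q)$. (2) If $\mathfrak c>\aleph_1$, then there is a $\sigma$-centered partial order $\mathbb P$ of size $\aleph_1$ such that for every ccc Souslin forcing notion $\mathbb Q$ there is no complete embedding of $\mathbb P$ into $\mathbb Q$, and none into $\mathrm{RO}^+(\mathbb Q)$. -/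

import Mathlib

/-! Forcing notions are (pre)orders in which the stronger condition is the greater one. -/

namespace Forcing

universe u v

/-- Two conditions are compatible if they have a common upper bound. -/
def Compatible {P : Type u} [Preorder P] (p q : P) : Prop :=
  ∃ r : P, p ≤ r ∧ q ≤ r

/-- The countable chain condition: every set of pairwise incompatible conditions is countable. -/
def CCC (P : Type u) [Preorder P] : Prop :=
  ∀ S : Set P, (S.Pairwise fun p q => ¬ Compatible p q) → S.Countable

/-- `P` is σ-centered if it is a countable union of centered sets, where a set is centered if
each of its finite subsets has an upper bound in `P`. -/
def SigmaCentered (P : Type u) [Preorder P] : Prop :=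
  ∃ C : ℕ → Set P, (∀ p, ∃ n, p ∈ C n) ∧
    ∀ (n : ℕ) (s : Finset P), (∀ p ∈ s, p ∈ C n) → ∃ q : P, ∀ p ∈ s, p ≤ q

/-- Complete embeddings of forcing notions: the order and incompatibility are preserved, and every
condition of the target has a reduction in the source. -/
structure IsCompleteEmbedding {P : Type u} {Q : Type v} [Preorder P] [Preorder Q]
    (i : P → Q) : Prop where
  map_le : ∀ p p' : P, p ≤ p' → i p ≤ i p'
  map_incompatible : ∀ p p' : P, ¬ Compatible p p' → ¬ Compatible (i p) (i p')
  exists_reduction : ∀ q : Q, ∃ p : P, ∀ p' : P, p ≤ p' → Compatible (i p') q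

/-- `P` can be completely embedded into `Q`. -/
def CompletelyEmbeds (P : Type u) (Q : Type v) [Preorder P] [Preorder Q] : Prop :=
  ∃ i : P → Q, IsCompleteEmbedding i

/-- The nonzero elements of the Boolean completion of `Q`: the nonempty regular open subsets of `Q`
for the topology whose open sets are the sets closed under passing to stronger conditions. An open
set `U` is regular iff it contains every condition above which it is dense. -/
structure Completion (Q : Type u) [Preorder Q] where
  carrier : Set Q
  nonempty : carrier.Nonempty
  isUpperSet : IsUpperSet carrier
  regular : ∀ q : Q, (∀ q', q ≤ q' → ∃ q'', q' ≤ q'' ∧ q'' ∈ carrier) → q ∈ carrier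

/-- The stronger (that is, greater) element of the completion is the smaller regular open set. -/
instance (Q : Type u) [Preorder Q] : Preorder (Completion Q) where
  le U V := V.carrier ⊆ U.carrier
  le_refl _ := subset_rfl
  le_trans _ _ _ h₁ h₂ := h₂.trans h₁

/-- A Souslin forcing notion: a preorder on a set `Q` of points of the (Polish) space `X` such that
`Q` is analytic in `X`, and the order and the incompatibility relation of `Q` are analytic
in `X × X`. -/
structure IsSouslin {X : Type u} [TopologicalSpace X] (Q : Set X) [Preorder Q] : Prop where
  analytic_carrier : MeasureTheory.AnalyticSet Q
  analytic_le : MeasureTheory.AnalyticSet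
    {z : X × X | ∃ p q : Q, p ≤ q ∧ z = (p.1, q.1)}
  analytic_incompatible : MeasureTheory.AnalyticSet
    {z : X × X | ∃ p q : Q, ¬ Compatible p q ∧ z = (p.1, q.1)}

/-- `ν ⊆ η`: the finite binary sequence `ν` is an initial segment of `η`. -/
def IsInitialSegment (ν : List Bool) (η : ℕ → Bool) : Prop :=
  ∀ (k : ℕ) (hk : k < ν.length), ν[k] = η k

/-- Conditions `⟨r, w⟩` of the forcing notion attached to `A`: `r` is a finite partial function from
finite binary sequences to `2` (with `none` for "not in the domain") and `w` is a finite subset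
of `A`. -/
@[ext]
structure QA (A : Set (ℕ → Bool)) where
  r : List Bool → Option Bool
  w : Set (ℕ → Bool)
  finite_dom : {ν | r ν ≠ none}.Finite
  finite_w : w.Finite
  w_subset : w ⊆ A

/-- `⟨r₁, w₁⟩ ≤ ⟨r₂, w₂⟩` iff `r₁ ⊆ r₂`, `w₁ ⊆ w₂`, and `r₂ ν = 1` for every
`ν ∈ dom r₂ \ dom r₁` that is an initial segment of some member of `w₁`. -/
instance (A : Set (ℕ → Bool)) : PartialOrder (QA A) where
  le a b := (∀ ν c, a.r ν = some c → b.r ν = some c) ∧ a.w ⊆ b.w ∧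
    ∀ ν, b.r ν ≠ none → a.r ν = none → (∃ η ∈ a.w, IsInitialSegment ν η) → b.r ν = some true
  le_refl a := ⟨fun _ _ h => h, subset_rfl, fun _ h h' _ => absurd h' h⟩
  le_trans a b c hab hbc := by
    refine ⟨fun ν x h => hbc.1 ν x (hab.1 ν x h), hab.2.1.trans hbc.2.1, ?_⟩
    rintro ν hc ha ⟨η, hη, hν⟩
    by_cases hb : b.r ν = none
    · exact hbc.2.2 ν hc hb ⟨η, hab.2.1 hη, hν⟩
    · exact hbc.1 ν true (hab.2.2 ν hb ha ⟨η, hη, hν⟩)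
  le_antisymm a b hab hba := by
    refine QA.ext (funext fun ν => Option.ext fun c => ?_) (hab.2.1.antisymm hba.2.1)
    exact ⟨hab.1 ν c, hba.1 ν c⟩

end Forcing

/-! A complete embedding `i` of `QA A` into the completion of a ccc Souslin `Q` makes `A` analytic.
By ccc, each regular open set `i (zeroAt A ν)` has a countable predense subset. If `η ∈ A`, any `q`
in `i (promise hη)` is incompatible with all these conditions for all initial segments `ν` of `η`.
If `η ∉ A`, no `q` is: a reduction of `q` can be extended to force the value 0 at some segment of
`η` (`exists_ge_zeroAt_segment`). As incompatibility is analytic, `A` is a projection of a countable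
intersection of analytic sets. For (2), take `A` of size `ℵ₁ < 𝔠`; it is not analytic by the perfect
set argument (`continuum_le_mk_of_analyticSet`). -/

open MeasureTheory Set

namespace Forcing

universe u v

/-! ### Perfect set argument for continuous images. -/

section PerfectSet

variable {α β : Type*} [MetricSpace α] [SecondCountableTopology α] {f : α → β}

/-- If the image of `E` is uncountable then so is the image of the set of those points of `E`
all of whose neighbourhoods in `E` have uncountable image. -/
theorem not_countable_image_condensation {E : Set α} (hE : ¬ (f '' E).Countable) :
    ¬ (f '' {x ∈ E | ∀ U, IsOpen U → x ∈ U → ¬ (f '' (E ∩ U)).Countable}).Countable := by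
  intro h
  refine hE (Countable.mono ?_ (h.union (Countable.biUnion
    (s := {U ∈ TopologicalSpace.countableBasis α | (f '' (E ∩ U)).Countable})
    ((TopologicalSpace.countable_countableBasis α).mono (sep_subset _ _))
    (t := fun U _ => f '' (E ∩ U)) fun U hU => hU.2)))
  rintro _ ⟨x, hx, rfl⟩
  by_cases hc : ∀ U, IsOpen U → x ∈ U → ¬ (f '' (E ∩ U)).Countable
  · exact Or.inl ⟨x, ⟨hx, hc⟩, rfl⟩
  · push Not at hc
    obtain ⟨U, hU, hxU, hcU⟩ := hc
    obtain ⟨V, hV, hxV, hVU⟩ :=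
      (TopologicalSpace.isBasis_countableBasis α).exists_subset_of_mem_open hxU hU
    refine Or.inr (mem_biUnion ⟨hV, hcU.mono ?_⟩ ⟨x, ⟨hx, hxV⟩, rfl⟩)
    exact image_mono (inter_subset_inter_right _ hVU)

/-- Two condensation points with distinct images are separated downstairs; small closed balls around
them, cut with `E`, are the two pieces. -/
theorem exists_small_diam_splitting_image [TopologicalSpace β] [T2Space β] (hf : Continuous f) {E : Set α}
    (hE : IsClosed E ∧ ¬ (f '' E).Countable) {ε : ENNReal} (hε : 0 < ε) :
    ∃ E₀ E₁ : Set α, ((IsClosed E₀ ∧ ¬ (f '' E₀).Countable) ∧ E₀ ⊆ E ∧ Metric.ediam E₀ ≤ ε) ∧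
      ((IsClosed E₁ ∧ ¬ (f '' E₁).Countable) ∧ E₁ ⊆ E ∧ Metric.ediam E₁ ≤ ε) ∧
      Disjoint (f '' E₀) (f '' E₁) := by
  have key : ∀ x ∈ {x ∈ E | ∀ U, IsOpen U → x ∈ U → ¬ (f '' (E ∩ U)).Countable},
      ∀ U : Set β, IsOpen U → f x ∈ U → ∃ F : Set α, (IsClosed F ∧ ¬ (f '' F).Countable) ∧
        F ⊆ E ∧ Metric.ediam F ≤ ε ∧ f '' F ⊆ U := by
    rintro x ⟨hxE, hx⟩ U hU hxU
    obtain ⟨δ, hδ, hδU⟩ := Metric.nhds_basis_closedEBall.mem_iff.1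
      ((hU.preimage hf).mem_nhds hxU)
    -- Radius `δ` keeps the image inside `U`; `ε / 2` bounds the diameter by `ε`.
    have hε2 : 0 < min δ (ε / 2) := lt_min hδ (ENNReal.half_pos hε.ne')
    refine ⟨E ∩ Metric.closedEBall x (min δ (ε / 2)),
      ⟨hE.1.inter Metric.isClosed_closedEBall, fun h => ?_⟩, inter_subset_left, ?_, ?_⟩
    · refine hx _ Metric.isOpen_eball (Metric.mem_eball_self hε2) (h.mono (image_mono ?_))
      exact inter_subset_inter_right _ Metric.eball_subset_closedEBall
    · refine (Metric.ediam_mono (inter_subset_right.trans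
        (Metric.closedEBall_subset_closedEBall (min_le_right _ _)))).trans ?_
      refine Metric.ediam_closedEBall_le.trans ?_
      rw [ENNReal.mul_div_cancel (by norm_num) (by norm_num)]
    · rintro _ ⟨y, hy, rfl⟩
      exact hδU (Metric.closedEBall_subset_closedEBall (min_le_left _ _) hy.2)
  have hnt : (f '' {x ∈ E | ∀ U, IsOpen U → x ∈ U → ¬ (f '' (E ∩ U)).Countable}).Nontrivial := by
    by_contra h
    exact not_countable_image_condensation hE.2 (not_nontrivial_iff.1 h).finite.countable
  obtain ⟨_, ⟨x, hx, rfl⟩, _, ⟨y, hy, rfl⟩, hxy⟩ := hnt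
  obtain ⟨U, V, hU, hV, hxU, hyV, hUV⟩ := t2_separation hxy
  obtain ⟨F, hF, hFE, hFd, hFU⟩ := key x hx U hU hxU
  obtain ⟨G, hG, hGE, hGd, hGV⟩ := key y hy V hV hyV
  exact ⟨F, G, ⟨hF, hFE, hFd⟩, ⟨hG, hGE, hGd⟩, hUV.mono hFU hGV⟩

-- Completeness and vanishing diameters put a point on every branch of the scheme `D`; injectivity
-- comes from the scheme of images `f '' D l`, which is disjoint.
open CantorScheme Filter in
theorem exists_nat_bool_injection_range [TopologicalSpace β] [T2Space β] [CompleteSpace α]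
    (hf : Continuous f)
    (hunc : ¬ (range f).Countable) :
    ∃ g : (ℕ → Bool) → β, range g ⊆ range f ∧ Function.Injective g := by
  obtain ⟨u, -, upos', hu⟩ := exists_seq_strictAnti_tendsto' (zero_lt_one' ENNReal)
  have upos := fun n => (upos' n).1
  let P := Subtype fun E : Set α => IsClosed E ∧ ¬ (f '' E).Countable
  choose C0 C1 h0 h1 hdisj using
    fun {E : Set α} (hE : IsClosed E ∧ ¬ (f '' E).Countable) {ε : ENNReal} (hε : 0 < ε) =>
    exists_small_diam_splitting_image hf hE hε
  let DP : List Bool → P := fun l => by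
    induction l with
    | nil => exact ⟨univ, isClosed_univ, by rwa [image_univ]⟩
    | cons a l ih =>
      cases a
      · exact ⟨C0 ih.property (upos (l.length + 1)), (h0 _ _).1⟩
      · exact ⟨C1 ih.property (upos (l.length + 1)), (h1 _ _).1⟩
  let D : List Bool → Set α := fun l => (DP l).val
  have hanti : ClosureAntitone D := by
    refine Antitone.closureAntitone ?_ fun l => (DP l).property.1
    intro l a
    cases a
    · exact (h0 _ _).2.1
    · exact (h1 _ _).2.1
  have hdiam : VanishingDiam D := by
    intro x
    apply tendsto_of_tendsto_of_tendsto_of_le_of_le' tendsto_const_nhds hu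
    · simp
    rw [eventually_atTop]
    -- Level 0 is `univ`, which carries no diameter bound.
    refine ⟨1, fun m (hm : 1 ≤ m) => ?_⟩
    rw [Nat.one_le_iff_ne_zero] at hm
    rcases Nat.exists_eq_succ_of_ne_zero hm with ⟨n, rfl⟩
    dsimp
    cases x n
    · convert! (h0 _ _).2.2
      rw [PiNat.res_length]
    · convert! (h1 _ _).2.2
      rw [PiNat.res_length]
  have hdisj' : CantorScheme.Disjoint fun l => f '' D l := by
    rintro l (a | a) (b | b) hab <;> try contradiction
    · exact hdisj _ _
    · exact (hdisj _ _).symm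
  have hne : ∀ l, (D l).Nonempty := fun l => by
    refine nonempty_iff_ne_empty.2 fun h => (DP l).property.2 ?_
    change (f '' D l).Countable
    simp [h]
  have hdom : ∀ x : ℕ → Bool, x ∈ (inducedMap fun l => f '' D l).1 := fun x => by
    have hx : x ∈ (inducedMap D).1 := by
      rw [hanti.map_of_vanishingDiam hdiam hne]
      apply mem_univ
    exact ⟨f ((inducedMap D).2 ⟨x, hx⟩), mem_iInter.2 fun n => ⟨_, map_mem ⟨x, hx⟩ n, rfl⟩⟩
  refine ⟨fun x => (inducedMap fun l => f '' D l).2 ⟨x, hdom x⟩, ?_, ?_⟩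
  · rintro y ⟨x, rfl⟩
    exact image_subset_range _ _ (map_mem ⟨x, hdom x⟩ 0)
  · intro x y hxy
    simpa only [← Subtype.val_inj] using hdisj'.map_injective hxy

end PerfectSet

/-- An uncountable analytic set has at least the cardinality of the continuum. -/
theorem continuum_le_mk_of_analyticSet {β : Type} [TopologicalSpace β] [T2Space β] {A : Set β}
    (hA : AnalyticSet A) (hunc : ¬ A.Countable) : Cardinal.continuum ≤ Cardinal.mk A := by
  obtain ⟨γ, _, _, f, hf, rfl⟩ := analyticSet_iff_exists_polishSpace_range.1 hA
  let := TopologicalSpace.upgradeIsCompletelyMetrizable γ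
  obtain ⟨g, hg, hinj⟩ := exists_nat_bool_injection_range hf hunc
  have h := Cardinal.mk_le_of_injective (f := fun x => (⟨g x, hg ⟨x, rfl⟩⟩ : range f))
    fun x y h => hinj (congrArg Subtype.val h)
  rwa [Cardinal.mk_arrow, Cardinal.mk_bool, Cardinal.mk_nat, Cardinal.lift_ofNat, Cardinal.lift_aleph0,
    Cardinal.two_power_aleph0] at h

/-! ### Compatibility in the Boolean completion, and ccc. -/

section Completion

variable {Q : Type u} [Preorder Q]

theorem Compatible.of_le {p q p' q' : Q} (h : Compatible p' q') (hp : p ≤ p') (hq : q ≤ q') :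
    Compatible p q := by
  obtain ⟨r, hr, hr'⟩ := h
  exact ⟨r, hp.trans hr, hq.trans hr'⟩

theorem Compatible.symm {p q : Q} (h : Compatible p q) : Compatible q p := by
  obtain ⟨r, hr, hr'⟩ := h
  exact ⟨r, hr', hr⟩

/-- The regular open set generated by a condition. -/
def Completion.principal (q : Q) : Completion Q where
  carrier := {x | ∀ x', x ≤ x' → Compatible x' q}
  nonempty := ⟨q, fun x hx => ⟨x, le_rfl, hx⟩⟩
  isUpperSet := fun _ _ h hx _ h' => hx _ (h.trans h')
  regular := fun _ h x hx => by
    obtain ⟨y, hxy, hy⟩ := h x hx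
    exact (hy y le_rfl).of_le hxy le_rfl

theorem Completion.compatible_iff {U V : Completion Q} :
    Compatible U V ↔ (U.carrier ∩ V.carrier).Nonempty := by
  constructor
  · rintro ⟨W, hU, hV⟩
    obtain ⟨x, hx⟩ := W.nonempty
    exact ⟨x, hU hx, hV hx⟩
  · intro h
    refine ⟨⟨U.carrier ∩ V.carrier, h, U.isUpperSet.inter V.isUpperSet, fun q hq =>
      ⟨U.regular q fun q' hq' => ?_, V.regular q fun q' hq' => ?_⟩⟩,
      inter_subset_left, inter_subset_right⟩
    · obtain ⟨x, hx, hx'⟩ := hq q' hq'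
      exact ⟨x, hx, hx'.1⟩
    · obtain ⟨x, hx, hx'⟩ := hq q' hq'
      exact ⟨x, hx, hx'.2⟩

theorem Completion.mem_principal_self (q : Q) : q ∈ (principal q).carrier :=
  fun x hx => ⟨x, le_rfl, hx⟩

/-- An open set meeting the regular open set generated by `q` has an element stronger
than `q`. -/
theorem Completion.exists_ge_of_compatible_principal {U : Completion Q} {q : Q}
    (h : Compatible U (principal q)) : ∃ x ∈ U.carrier, q ≤ x := by
  obtain ⟨x, hxU, hx⟩ := compatible_iff.1 h
  obtain ⟨y, hxy, hqy⟩ := hx x le_rfl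
  exact ⟨y, U.isUpperSet hxy hxU, hqy⟩

/-- Reduces non-embeddability into `Q` to non-embeddability into its completion. -/
theorem CompletelyEmbeds.completion {P : Type v} [Preorder P] (h : CompletelyEmbeds P Q) :
    CompletelyEmbeds P (Completion Q) := by
  obtain ⟨i, hi⟩ := h
  refine ⟨fun p => Completion.principal (i p), ⟨fun p p' hp x hx y hy => ?_,
    fun p p' hp hc => ?_, fun U => ?_⟩⟩
  · exact (hx y hy).of_le le_rfl (hi.map_le p p' hp)
  · obtain ⟨x, hx, hpx⟩ := Completion.exists_ge_of_compatible_principal hc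
    exact hi.map_incompatible p p' hp ((hx x le_rfl).symm.of_le le_rfl hpx)
  · obtain ⟨q, hq⟩ := U.nonempty
    obtain ⟨p, hp⟩ := hi.exists_reduction q
    refine ⟨p, fun p' hp' => Completion.compatible_iff.2 ?_⟩
    obtain ⟨x, hpx, hqx⟩ := hp p' hp'
    exact ⟨x, (Completion.principal _).isUpperSet hpx (Completion.mem_principal_self _),
      U.isUpperSet hqx hq⟩

/-- In a ccc forcing notion, every nonempty set has a countable predense subset. -/
theorem CCC.exists_seq_predense (hQ : CCC Q) {U : Set Q} (hU : U.Nonempty) :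
    ∃ a : ℕ → Q, (∀ m, a m ∈ U) ∧ ∀ x ∈ U, ∃ m, Compatible x (a m) := by
  -- A maximal antichain inside `U`: predense in `U` by maximality, countable by ccc.
  obtain ⟨S, -, hS⟩ := zorn_subset_nonempty
    {S : Set Q | S ⊆ U ∧ S.Pairwise fun p q => ¬ Compatible p q}
    (fun c hc hchain _ => ⟨⋃₀ c, ⟨sUnion_subset fun s hs => (hc hs).1,
      (pairwise_sUnion hchain.directedOn).2 fun s hs => (hc hs).2⟩,
      fun s hs => subset_sUnion_of_mem hs⟩) ∅ ⟨empty_subset _, pairwise_empty _⟩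
  have hmax : ∀ x ∈ U, ∃ y ∈ S, Compatible x y := by
    intro x hx
    by_contra h
    push Not at h
    have : Std.Symm fun p q : Q => ¬ Compatible p q := ⟨fun a b hab hba => hab hba.symm⟩
    have hxS : x ∈ S := hS.le_of_ge (y := insert x S) ⟨insert_subset hx hS.prop.1,
      pairwise_insert_of_symm.2
        ⟨hS.prop.2, fun y hy _ => h y hy⟩⟩ (subset_insert _ _) (mem_insert _ _)
    exact h x hxS ⟨x, le_rfl, le_rfl⟩
  obtain ⟨x, hx⟩ := hU
  obtain ⟨y, hy, -⟩ := hmax x hx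
  obtain ⟨a, rfl⟩ := (hQ S hS.prop.2).exists_eq_range ⟨y, hy⟩
  exact ⟨a, fun m => hS.prop.1 ⟨m, rfl⟩, fun x hx => by simpa using hmax x hx⟩

end Completion

/-! ### The forcing `QA A` and the analyticity of `A`. -/

namespace QA

variable {A : Set (ℕ → Bool)}

/-- The graph of the finite partial function `r` of a condition. -/
noncomputable def graph (a : QA A) : Finset (List Bool × Bool) :=
  Set.Finite.toFinset (s := {z | a.r z.1 = some z.2}) <| by
    refine (a.finite_dom.prod (Set.finite_univ (α := Bool))).subset ?_
    rintro ⟨ν, c⟩ h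
    have h : a.r ν = some c := h
    exact ⟨by simp [h], mem_univ _⟩

theorem r_eq_of_graph_eq {a b : QA A} (h : a.graph = b.graph) : a.r = b.r := by
  refine funext fun ν => Option.ext fun c => ?_
  simpa [graph] using Finset.ext_iff.1 h (ν, c)

/-- There are countably many `r`, and conditions sharing `r` are bounded by the union of their `w`:
since `r` does not grow, no promise is tested. -/
theorem sigmaCentered (A : Set (ℕ → Bool)) : SigmaCentered (QA A) := by
  obtain ⟨e, he⟩ := exists_injective_nat (Finset (List Bool × Bool))
  refine ⟨fun n => {a | e a.graph = n}, fun p => ⟨_, rfl⟩, fun n s hs => ?_⟩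
  obtain rfl | ⟨p, hp⟩ := s.eq_empty_or_nonempty
  · exact ⟨⟨fun _ => none, ∅, by simp, finite_empty, empty_subset _⟩, by simp⟩
  refine ⟨⟨p.r, ⋃ q ∈ s, q.w, p.finite_dom, s.finite_toSet.biUnion fun q _ => q.finite_w,
    iUnion₂_subset fun q _ => q.w_subset⟩, fun q hq => ?_⟩
  have hr : q.r = p.r := r_eq_of_graph_eq (he ((hs q hq).trans (hs p hp).symm))
  refine ⟨fun ν c h => by rw [← hr]; exact h, subset_biUnion_of_mem (u := fun q : QA A => q.w) hq,
    fun ν h h' => ?_⟩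
  exact absurd (hr ▸ h') h

/-- The condition forcing the value `0` at `ν`. -/
noncomputable def zeroAt (A : Set (ℕ → Bool)) (ν : List Bool) : QA A where
  r := Function.update (fun _ => none) ν (some false)
  w := ∅
  finite_dom := (finite_singleton ν).subset fun μ h => by
    by_contra hμ
    exact h (Function.update_of_ne hμ _ _)
  finite_w := finite_empty
  w_subset := empty_subset _

/-- The condition promising `1` at the new initial segments of `η`. -/
def promise {η : ℕ → Bool} (hη : η ∈ A) : QA A where
  r := fun _ => none
  w := {η}
  finite_dom := by simp
  finite_w := finite_singleton η
  w_subset := singleton_subset_iff.2 hη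

theorem not_compatible_promise_zeroAt {η : ℕ → Bool} (hη : η ∈ A) {ν : List Bool}
    (hν : IsInitialSegment ν η) : ¬ Compatible (promise hη) (zeroAt A ν) := by
  rintro ⟨a, ha, ha'⟩
  have h0 : a.r ν = some false := ha'.1 ν false (by simp [zeroAt])
  have h1 : a.r ν = some true := ha.2.2 ν (by simp [h0]) rfl ⟨η, rfl, hν⟩
  simp [h0] at h1

/-- The initial segment of `η` of length `n`. -/
def segment (η : ℕ → Bool) (n : ℕ) : List Bool := List.ofFn fun k : Fin n => η k

theorem isInitialSegment_segment_iff {η ζ : ℕ → Bool} {n : ℕ} :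
    IsInitialSegment (segment η n) ζ ↔ ∀ k < n, η k = ζ k := by
  simp [IsInitialSegment, segment]

theorem segment_injective (η : ℕ → Bool) : Function.Injective (segment η) := fun m n h => by
  simpa [segment] using congrArg List.length h

/-- Only finitely many coordinates matter, so `g` may be arbitrary, such as a chosen predense
sequence. -/
theorem continuous_segment (n : ℕ) {Y : Type*} [TopologicalSpace Y] (g : List Bool → Y) :
    Continuous fun η => g (segment η n) := by
  have h : Continuous fun t : Fin n → Bool => g (List.ofFn t) := continuous_of_discreteTopology
  exact h.comp (continuous_pi fun k => continuous_apply (k : ℕ))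

/-- A condition whose second coordinate omits `η` has an extension taking the value `0` at a
long initial segment of `η`. -/
theorem exists_ge_zeroAt_segment (a : QA A) {η : ℕ → Bool} (hη : η ∉ A) :
    ∃ n, ∃ b, a ≤ b ∧ zeroAt A (segment η n) ≤ b := by
  have h1 : {n | a.r (segment η n) ≠ none}.Finite :=
    a.finite_dom.preimage (segment_injective η).injOn
  have h2 : {n | ∃ ζ ∈ a.w, IsInitialSegment (segment η n) ζ}.Finite := by
    have : {n | ∃ ζ ∈ a.w, IsInitialSegment (segment η n) ζ} =
        ⋃ ζ ∈ a.w, {n | IsInitialSegment (segment η n) ζ} := by ext; simp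
    rw [this]
    refine a.finite_w.biUnion fun ζ hζ => ?_
    have hne : η ≠ ζ := fun h => hη (h ▸ a.w_subset hζ)
    obtain ⟨k, hk⟩ := Function.ne_iff.1 hne
    refine (finite_Iic k).subset fun n hn => ?_
    by_contra hkn
    exact hk (isInitialSegment_segment_iff.1 hn k (not_le.1 hkn))
  -- At this length the segment is outside the domain of `a.r` and subject to no promise of `a`, so
  -- 0 is allowed there.
  obtain ⟨n, hn⟩ := (h1.union h2).exists_notMem
  have hn1 : a.r (segment η n) = none := by
    by_contra h
    exact hn (Or.inl h)
  have hn2 : ¬ ∃ ζ ∈ a.w, IsInitialSegment (segment η n) ζ := fun h => hn (Or.inr h)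
  refine ⟨n, ⟨Function.update a.r (segment η n) (some false), a.w,
    (a.finite_dom.insert (segment η n)).subset fun μ h => ?_, a.finite_w, a.w_subset⟩,
    ⟨fun ν c h => ?_, subset_rfl, fun ν h h' hν => ?_⟩, fun ν c h => ?_, empty_subset _,
    fun ν h h' hν => ?_⟩
  · by_cases hμ : μ = segment η n
    · exact Or.inl hμ
    · exact Or.inr fun h' => h ((Function.update_of_ne hμ _ _).trans h')
  · refine (Function.update_of_ne ?_ _ _).trans h
    rintro rfl
    simp [hn1] at h
  · by_cases hμ : ν = segment η n
    · exact absurd (hμ ▸ hν) hn2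
    · exact absurd ((Function.update_of_ne hμ _ _).trans h') h
  · by_cases hμ : ν = segment η n
    · subst hμ
      simpa [zeroAt] using h
    · simp [zeroAt, Function.update_of_ne hμ] at h
  · simp [zeroAt] at hν

/-- If `QA A` completely embeds into the completion of a ccc Souslin forcing notion, then `A` is
analytic: `η ∈ A` iff some condition is incompatible with the Boolean values of `r ν = 0` for all
initial segments `ν` of `η`, and these values have countable predense sets. -/
theorem analyticSet_of_completelyEmbeds {X : Type u} [TopologicalSpace X] [PolishSpace X]
    {Q : Set X} [Preorder Q] (hQ : IsSouslin Q) (hccc : CCC Q)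
    (h : CompletelyEmbeds (QA A) (Completion Q)) : AnalyticSet A := by
  obtain ⟨i, hi⟩ := h
  choose a ha hpre using fun ν => hccc.exists_seq_predense (i (zeroAt A ν)).nonempty
  have hA : A = Prod.fst '' ⋂ nm : ℕ × ℕ, (fun z : (ℕ → Bool) × X =>
      (z.2, (a (segment z.1 nm.1) nm.2 : X))) ⁻¹'
        {z : X × X | ∃ p q : Q, ¬ Compatible p q ∧ z = (p.1, q.1)} := by
    ext η
    constructor
    · intro hη
      obtain ⟨q, hq⟩ := (i (promise hη)).nonempty
      refine ⟨(η, q), mem_iInter.2 fun nm => ⟨q, a (segment η nm.1) nm.2, ?_, rfl⟩, rfl⟩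
      rintro ⟨x, hqx, hax⟩
      refine hi.map_incompatible _ _ (not_compatible_promise_zeroAt hη
        (isInitialSegment_segment_iff.2 fun k _ => rfl : IsInitialSegment (segment η nm.1) η))
        (Completion.compatible_iff.2 ⟨x, (i _).isUpperSet hqx hq, (i _).isUpperSet hax (ha _ _)⟩)
    · rintro ⟨⟨η', x⟩, hx, rfl⟩
      rw [mem_iInter] at hx
      by_contra hη
      -- The index is irrelevant: this only shows that `x` lies in `Q`.
      obtain ⟨q, _, _, hq⟩ := hx (0, 0)
      obtain rfl : x = q := congrArg Prod.fst hq
      obtain ⟨p, hp⟩ := hi.exists_reduction (Completion.principal q)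
      obtain ⟨n, p', hpp', hzp'⟩ := exists_ge_zeroAt_segment p hη
      -- `y` is above `q` and lies in `i (zeroAt A (segment η' n))`, so predensity makes some `a _
      -- m` compatible with `q`.
      obtain ⟨y, hy, hqy⟩ := Completion.exists_ge_of_compatible_principal (hp p' hpp')
      obtain ⟨m, hm⟩ := hpre _ y (hi.map_le _ _ hzp' hy)
      obtain ⟨q', b, hinc, heq⟩ := hx (n, m)
      obtain rfl : q = q' := Subtype.ext (congrArg Prod.fst heq)
      obtain rfl : a (segment η' n) m = b := Subtype.ext (congrArg Prod.snd heq)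
      exact hinc (hm.of_le hqy le_rfl)
  have : PolishSpace (ℕ → Bool) := {}
  have : PolishSpace ((ℕ → Bool) × X) := {}
  rw [hA]
  refine AnalyticSet.image_of_continuous (AnalyticSet.iInter fun nm => ?_) continuous_fst
  refine hQ.analytic_incompatible.preimage (continuous_snd.prodMk ?_)
  exact (continuous_segment nm.1 fun ν => (a ν nm.2 : X)).comp continuous_fst

theorem not_completelyEmbeds (hA : ¬ AnalyticSet A) {X : Type u} [TopologicalSpace X]
    [PolishSpace X] (Q : Set X) [Preorder Q] (hQ : IsSouslin Q) (hccc : CCC Q) :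
    ¬ CompletelyEmbeds (QA A) Q ∧ ¬ CompletelyEmbeds (QA A) (Completion Q) :=
  ⟨fun h => hA (analyticSet_of_completelyEmbeds hQ hccc h.completion),
    fun h => hA (analyticSet_of_completelyEmbeds hQ hccc h)⟩

-- A condition is coded by a finite subset of a countable set and a finite subset of `A`.
open Cardinal in
theorem mk_eq_of_infinite [Infinite A] : #(QA A) = #A := by
  apply le_antisymm
  · have h : Function.Injective fun a : QA A =>
        (a.graph, (a.finite_w.preimage Subtype.val_injective.injOn :
          ((↑) ⁻¹' a.w : Set A).Finite).toFinset) := by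
      intro a b hab
      refine QA.ext (r_eq_of_graph_eq (congrArg Prod.fst hab)) ?_
      have h2 := Set.Finite.toFinset_inj.1 (congrArg Prod.snd hab)
      rw [Subtype.preimage_val_eq_preimage_val_iff] at h2
      rwa [inter_eq_right.2 a.w_subset, inter_eq_right.2 b.w_subset] at h2
    refine (mk_le_of_injective h).trans ?_
    rw [mk_prod, lift_id, lift_id, mk_finset_of_infinite A]
    exact (mul_le_mul_left (mk_le_aleph0.trans (aleph0_le_mk A)) _).trans
      (mul_eq_self (aleph0_le_mk A)).le
  · exact mk_le_of_injective (f := fun η : A => promise η.2) fun η ζ h =>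
      Subtype.ext (singleton_injective (congrArg QA.w h))

end QA

end Forcing

theorem mainTheorem8 :
    (∀ A : Set (ℕ → Bool),
      Forcing.SigmaCentered (Forcing.QA A) ∧
      (¬ MeasureTheory.AnalyticSet A →
        ∀ (X : Type*) [TopologicalSpace X] [PolishSpace X] (Q : Set X) [Preorder Q],
          Forcing.IsSouslin Q → Forcing.CCC Q →
            ¬ Forcing.CompletelyEmbeds (Forcing.QA A) Q ∧
            ¬ Forcing.CompletelyEmbeds (Forcing.QA A) (Forcing.Completion Q))) ∧
    (Cardinal.aleph 1 < Cardinal.continuum.{0} →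
      ∃ (P : Type) (_ : PartialOrder P),
        Forcing.SigmaCentered P ∧ Cardinal.mk P = Cardinal.aleph 1 ∧
        ∀ (X : Type*) [TopologicalSpace X] [PolishSpace X] (Q : Set X) [Preorder Q],
          Forcing.IsSouslin Q → Forcing.CCC Q →
            ¬ Forcing.CompletelyEmbeds P Q ∧
            ¬ Forcing.CompletelyEmbeds P (Forcing.Completion Q)) := by
  refine ⟨fun A => ⟨Forcing.QA.sigmaCentered A, fun hA X _ _ Q _ hQ hccc =>
    Forcing.QA.not_completelyEmbeds hA Q hQ hccc⟩, fun hc => ?_⟩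
  obtain ⟨A, hA⟩ : ∃ A : Set (ℕ → Bool), Cardinal.mk A = Cardinal.aleph 1 :=
    Cardinal.le_mk_iff_exists_set.1 (by simpa using hc.le)
  have hunc : ¬ A.Countable := by
    rw [← Cardinal.le_aleph0_iff_set_countable, hA, not_le]
    exact Cardinal.aleph0_lt_aleph_one
  have hinf : Infinite A := Set.infinite_coe_iff.2 fun h => hunc h.countable
  refine ⟨Forcing.QA A, inferInstance, Forcing.QA.sigmaCentered A,
    Forcing.QA.mk_eq_of_infinite.trans hA, fun X _ _ Q _ hQ hccc =>
    Forcing.QA.not_completelyEmbeds (fun h => ?_) Q hQ hccc⟩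
  exact (hA ▸ Forcing.continuum_le_mk_of_analyticSet h hunc).not_gt hc
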